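/- Throughout, $\log$ is the base-two logarithm and $\ln$ the natural one. For a unit vector (pure state) $|\psi\rangle\in\mathbb C^d$ let $p_{|\psi\rangle}(x)=|\langle x|\psi\rangle|^2$ be the distribution of the outcome of measuring $|\psi\rangle$ in the computational (standard) basis, let $H(p)=-\sum_x p(x)\log p(x)$ be the Shannon entropy (with $0\log 0=0$), and let $\eta(\epsilon)=-2\epsilon\ln(2\epsilon)$ for $\epsilon>0$. There exists a universal constant $c'\ge 1$ such that the following hold. (1) For all integers $d>2$ and $t>2$ with $\frac{9\cdot 16^2\, t}{18\log t}\le d$ there exist unitary transformations $U_0,\dots,U_{t-1}$ of $\mathbb C^d$ such that, for every state $|\psi\rangle\in\mathbb C^d$, $$\frac1t\sum_{k=0}^{t-1}H\big(p_{U_k|\psi\rangle}\big)\ \ge\ \Big(1-\sqrt{\tfrac{c'\log t}{t}}\Big)\log d-\log\Big(\frac{18\,t}{c'\log t}\Big)-\eta\Big(\sqrt{\tfrac{c'\log t}{t}}\Big).$$ (2) For every integer $t>2$ there is a sequence, indexed by $d$, of families $U^{(d)}_0,\dots,U^{(d)}_{t-1}$ of unitary transformations of $\mathbb C^d$ such that,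 for every sequence of states $|\psi_d\rangle\in\mathbb C^d$ ($d\ge 1$), $$\liminf_{d\to\infty}\ \frac{\frac1t\sum_{k=0}^{t-1}H\big(p_{U^{(d)}_k|\psi_d\rangle}\big)}{\log d}\ \ge\ 1-\sqrt{\frac{c'\log t}{t}}.$$ (3) The bound in (2) is $1-1/f(t)$ with $f(t)=\sqrt{t/(c'\log t)}$, and $f(t)\to\infty$ as $t\to\infty$. (This answers affirmatively a question of Wehner and Winter, who asked whether a bound of the form $1-1/f(t)$ with a growing function $f$ is possible.) -/

import Mathlib

open Filter Topology

noncomputable section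

/-- The space `ℂ^d` with its Hermitian inner product; its coordinate basis is the
computational basis. -/
abbrev QSpace (d : ℕ) : Type := EuclideanSpace ℂ (Fin d)

/-- The unitary transformations of `ℂ^d`: the surjective linear isometries. -/
abbrev QUnitary (d : ℕ) : Type := QSpace d ≃ₗᵢ[ℂ] QSpace d

/-- Shannon entropy, in bits, of a distribution on a finite set (with `0 log 0 = 0`). -/
def shannonEntropy {ι : Type*} [Fintype ι] (p : ι → ℝ) : ℝ :=
  -∑ x, p x * Real.logb 2 (p x)

/-- Outcome distribution of the measurement of `ψ` in the computational basis:
`p(x) = |⟨x|ψ⟩|²`. -/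
def outcomeDist {d : ℕ} (ψ : QSpace d) : Fin d → ℝ :=
  fun x => ‖inner ℂ (EuclideanSpace.basisFun (Fin d) ℂ x) ψ‖ ^ 2

/-- Average measurement entropy `(1/t) ∑ₖ H(p_{Uₖ ψ})`. -/
def avgMeasurementEntropy {d t : ℕ} (U : Fin t → QUnitary d) (ψ : QSpace d) : ℝ :=
  (1 / (t : ℝ)) * ∑ k, shannonEntropy (outcomeDist (U k ψ))

/-- `η(ε) = -2 ε ln (2 ε)`, with the natural logarithm. -/
def etaFn (ε : ℝ) : ℝ := -2 * ε * Real.log (2 * ε)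

end

/-! Suitably random unitaries spread every state: for some `s` of order `d / log t`, any `s` of the
`t * d` outcomes `(k, x)` carry total probability at most 64, for all states at once. Hence fewer
than `s` outcomes have probability above `64 / s`. They hold at most 64 of the total mass `t`, and
every other outcome contributes surprisal at least `log (s / 64)`. So the average entropy is at
least `(1 - 64/t) log (s / 64)` (`le_avgMeasurementEntropy`), and with `c' = 64` calculus shows that
this, or nonnegativity of entropy, beats the target.

The spreading (`exists_qunitary_family_sum_sq_le`) is a net argument with exponential moments. For
Haar-random `U`, `Re ⟨a, U v⟩` is sub-Gaussian: invariance lets `a` be replaced by sign vectors of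
the same norm, whose exponential moments factor into cosines hyperbolic. Choosing the unitaries one
at a time controls the sum of exponentials over all pairs from a net of `s`-sparse test vectors and
a net of states. The number of pairs is below `exp (4 d)`, so no single term can be large, and the
bound passes from the nets to all vectors at the cost of a factor 2 each. -/

/-! ### Exponential moments of Haar-random matrix coefficients. -/

/-- Two vectors of the same norm are related by a unitary transformation. -/
theorem exists_unitary_apply_eq {d : ℕ} (a b : QSpace d) (h : ‖a‖ = ‖b‖) :
    ∃ V : unitary (QSpace d →L[ℂ] QSpace d), (V : QSpace d →L[ℂ] QSpace d) a = b := by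
  by_cases ha : a = 0
  · have hb : b = 0 := by simpa [ha] using h.symm
    exact ⟨1, by simp [ha, hb]⟩
  have hb : b ≠ 0 := by
    rintro rfl
    exact ha (by simpa using h)
  have hd : 0 < d := by
    rcases Nat.eq_zero_or_pos d with rfl | hd
    · exact absurd (Subsingleton.elim a 0) ha
    · exact hd
  -- Each nonzero vector is a multiple of the first vector of an orthonormal basis; the unitary
  -- carries one such basis to the other.
  have key : ∀ x : QSpace d, x ≠ 0 → ∃ B : OrthonormalBasis (Fin d) ℂ (QSpace d),
      x = (‖x‖ : ℂ) • B ⟨0, hd⟩ := by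
    intro x hx
    have hn : (‖x‖ : ℂ) ≠ 0 := by simpa using hx
    obtain ⟨B, hB⟩ := Orthonormal.exists_orthonormalBasis_extension_of_card_eq (𝕜 := ℂ)
      (E := QSpace d) (ι := Fin d) (by simp) (v := fun _ => (‖x‖ : ℂ)⁻¹ • x) (s := {⟨0, hd⟩}) (by
        constructor
        · intro i
          simp [norm_smul, hx]
        · intro i j hij
          exact absurd (Subsingleton.elim i j) hij)
    refine ⟨B, ?_⟩
    rw [hB ⟨0, hd⟩ (by simp), smul_smul, mul_inv_cancel₀ hn, one_smul]
  obtain ⟨A, hA⟩ := key a ha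
  obtain ⟨B, hB⟩ := key b hb
  refine ⟨Unitary.linearIsometryEquiv.symm (A.equiv B (Equiv.refl _)), ?_⟩
  rw [Unitary.coe_symm_linearIsometryEquiv_apply]
  show (A.equiv B (Equiv.refl _)) a = b
  rw [hA, map_smul, OrthonormalBasis.equiv_apply_basis, h]
  exact hB.symm

/-- The vector of `ℂ^d` whose real and imaginary coordinates are `± c`. -/
noncomputable def signVector {d : ℕ} (c : ℝ) (σ : Fin d → Bool × Bool) : QSpace d :=
  WithLp.toLp 2 fun j => ⟨if (σ j).1 then c else -c, if (σ j).2 then c else -c⟩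

theorem norm_sq_signVector {d : ℕ} (c : ℝ) (σ : Fin d → Bool × Bool) :
    ‖signVector c σ‖ ^ 2 = 2 * d * c ^ 2 := by
  rw [EuclideanSpace.norm_sq_eq]
  have : ∀ j, ‖(signVector c σ) j‖ ^ 2 = 2 * c ^ 2 := by
    intro j
    rw [Complex.sq_norm, Complex.normSq_apply]
    simp only [signVector]
    split_ifs <;> ring
  simp [this]
  ring

/-- The `2 d` signs are independent, so the sum factors over coordinates into products of `cosh`,
and `cosh x ≤ exp (x² / 2)`. -/
theorem sum_exp_inner_signVector_le {d : ℕ} (c : ℝ) (y : QSpace d) :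
    ∑ σ : Fin d → Bool × Bool, Real.exp (inner ℂ (signVector c σ) y).re
      ≤ (Fintype.card (Fin d → Bool × Bool) : ℝ) * Real.exp (c ^ 2 * ‖y‖ ^ 2 / 2) := by
  have h1 : ∀ σ : Fin d → Bool × Bool, Real.exp (inner ℂ (signVector c σ) y).re
      = ∏ j, Real.exp ((if (σ j).1 then c else -c) * (y j).re
          + (if (σ j).2 then c else -c) * (y j).im) := by
    intro σ
    rw [← Real.exp_sum, PiLp.inner_apply, Complex.re_sum]
    congr 1
    refine Finset.sum_congr rfl fun j _ => ?_
    simp only [signVector, RCLike.inner_apply, Complex.mul_re, Complex.conj_re, Complex.conj_im]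
    ring
  simp_rw [h1]
  have h2 := Finset.prod_univ_sum (fun _ : Fin d => (Finset.univ : Finset (Bool × Bool)))
    (fun j b => Real.exp ((if b.1 then c else -c) * (y j).re
          + (if b.2 then c else -c) * (y j).im))
  rw [Fintype.piFinset_univ] at h2
  rw [← h2]
  have h3 : ∀ j, ∑ b : Bool × Bool, Real.exp ((if b.1 then c else -c) * (y j).re
          + (if b.2 then c else -c) * (y j).im) ≤ 4 * Real.exp (c ^ 2 * ‖y j‖ ^ 2 / 2) := by
    intro j
    have e1 : ∑ b : Bool × Bool, Real.exp ((if b.1 then c else -c) * (y j).re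
          + (if b.2 then c else -c) * (y j).im)
        = 4 * (Real.cosh (c * (y j).re) * Real.cosh (c * (y j).im)) := by
      rw [Fintype.sum_prod_type, Real.cosh_eq, Real.cosh_eq]
      simp [Real.exp_add]
      ring
    rw [e1]
    have := mul_le_mul (Real.cosh_le_exp_half_sq (c * (y j).re))
      (Real.cosh_le_exp_half_sq (c * (y j).im)) (Real.cosh_pos _).le (Real.exp_pos _).le
    rw [← Real.exp_add] at this
    have e2 : (c * (y j).re) ^ 2 / 2 + (c * (y j).im) ^ 2 / 2 = c ^ 2 * ‖y j‖ ^ 2 / 2 := by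
      rw [Complex.sq_norm, Complex.normSq_apply]; ring
    rw [e2] at this
    linarith
  refine (Finset.prod_le_prod (fun j _ => Finset.sum_nonneg fun b _ => (Real.exp_pos _).le)
    fun j _ => h3 j).trans (le_of_eq ?_)
  rw [Finset.prod_mul_distrib, ← Real.exp_sum, EuclideanSpace.norm_sq_eq, Finset.mul_sum,
    Finset.sum_div]
  simp

/-- The unitary elements of the algebra of operators on `ℂ^d`. -/
abbrev UnitaryOp (d : ℕ) : Type := unitary (QSpace d →L[ℂ] QSpace d)

/-- An average over the unitary group of a random matrix coefficient is sub-Gaussian: there is a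
unitary-invariant probability measure for which the exponential moments are those of a Gaussian. -/
theorem exists_unitary_measure_exp_inner_le (d : ℕ) :
    ∃ (m : MeasurableSpace (UnitaryOp d))
      (μ : @MeasureTheory.Measure (UnitaryOp d) m),
      MeasureTheory.IsProbabilityMeasure μ ∧
      (∀ f : UnitaryOp d → ℝ, Continuous f → MeasureTheory.Integrable f μ) ∧
      ∀ a v : QSpace d,
        ∫ U, Real.exp (inner ℂ a ((U : QSpace d →L[ℂ] QSpace d) v)).re ∂μ
          ≤ Real.exp (‖a‖ ^ 2 * ‖v‖ ^ 2 / (4 * d)) := by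
  let : MeasurableSpace (UnitaryOp d) := borel (UnitaryOp d)
  have : BorelSpace (UnitaryOp d) := ⟨rfl⟩
  have : ContinuousStar (QSpace d →L[ℂ] QSpace d) :=
    ⟨(ContinuousLinearMap.adjoint (𝕜 := ℂ) (E := QSpace d) (F := QSpace d)).continuous⟩
  have : ProperSpace (QSpace d →L[ℂ] QSpace d) := FiniteDimensional.proper ℂ _
  have : CompactSpace (UnitaryOp d) := by
    refine isCompact_iff_compactSpace.mp
      (?_ : IsCompact (unitary (QSpace d →L[ℂ] QSpace d) : Set (QSpace d →L[ℂ] QSpace d)))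
    refine Metric.isCompact_of_isClosed_isBounded isClosed_unitary ?_
    refine (Metric.isBounded_closedBall (x := (0 : QSpace d →L[ℂ] QSpace d)) (r := 1)).subset ?_
    intro U hU
    rw [mem_closedBall_zero_iff]
    refine ContinuousLinearMap.opNorm_le_bound _ zero_le_one fun x => ?_
    rw [one_mul]
    exact (Unitary.norm_map (⟨U, hU⟩ : UnitaryOp d) x).le
  let K : TopologicalSpace.PositiveCompacts (UnitaryOp d) := ⊤
  let μ : MeasureTheory.Measure (UnitaryOp d) := MeasureTheory.Measure.haarMeasure K
  have hprob : MeasureTheory.IsProbabilityMeasure μ := by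
    constructor
    have := MeasureTheory.Measure.haarMeasure_self (K₀ := K)
    simpa [K] using this
  have hint : ∀ f : UnitaryOp d → ℝ, Continuous f → MeasureTheory.Integrable f μ := by
    intro f hf
    rw [← MeasureTheory.integrableOn_univ]
    exact hf.continuousOn.integrableOn_compact isCompact_univ
  refine ⟨borel (UnitaryOp d), μ, hprob, hint, fun a v => ?_⟩
  have hcont : ∀ a : QSpace d, Continuous fun U : UnitaryOp d =>
      Real.exp (inner ℂ a ((U : QSpace d →L[ℂ] QSpace d) v)).re := by
    intro a
    refine Real.continuous_exp.comp (Complex.continuous_re.comp ?_)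
    refine Continuous.inner continuous_const ?_
    exact (ContinuousLinearMap.apply ℂ (QSpace d) v).continuous.comp continuous_subtype_val
  have hinv : ∀ a b : QSpace d, ‖a‖ = ‖b‖ →
      ∫ U : UnitaryOp d, Real.exp (inner ℂ a ((U : QSpace d →L[ℂ] QSpace d) v)).re ∂μ
        = ∫ U : UnitaryOp d, Real.exp (inner ℂ b ((U : QSpace d →L[ℂ] QSpace d) v)).re ∂μ := by
    intro a b hab
    obtain ⟨V, hV⟩ := exists_unitary_apply_eq a b hab
    rw [← MeasureTheory.integral_mul_left_eq_self
      (fun U : UnitaryOp d => Real.exp (inner ℂ b ((U : QSpace d →L[ℂ] QSpace d) v)).re) V]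
    congr 1
    funext U
    rw [← hV, Submonoid.coe_mul, mul_apply_eq_comp, Unitary.inner_map_map]
  rcases Nat.eq_zero_or_pos d with rfl | hd
  · have : a = 0 := Subsingleton.elim _ _
    simp [this]
  have hd' : (0 : ℝ) < d := by exact_mod_cast hd
  -- This scale gives every sign vector the norm of `a`, so by invariance each has the same integral
  -- as `a`.
  set c : ℝ := ‖a‖ / Real.sqrt (2 * d) with hc
  have hc2 : c ^ 2 = ‖a‖ ^ 2 / (2 * d) := by
    rw [hc, div_pow, Real.sq_sqrt (by positivity)]
  have hn : ∀ σ : Fin d → Bool × Bool, ‖a‖ = ‖signVector c σ‖ := by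
    intro σ
    rw [← sq_eq_sq₀ (norm_nonneg _) (norm_nonneg _), norm_sq_signVector, hc2]
    field_simp
  have hN : (0 : ℝ) < (Fintype.card (Fin d → Bool × Bool) : ℝ) := by
    exact_mod_cast Fintype.card_pos
  have havg : (Fintype.card (Fin d → Bool × Bool) : ℝ) *
      ∫ U : UnitaryOp d, Real.exp (inner ℂ a ((U : QSpace d →L[ℂ] QSpace d) v)).re ∂μ
      = ∫ U : UnitaryOp d, ∑ σ : Fin d → Bool × Bool,
        Real.exp (inner ℂ (signVector c σ) ((U : QSpace d →L[ℂ] QSpace d) v)).re ∂μ := by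
    rw [MeasureTheory.integral_finsetSum _ fun σ _ => hint _ (hcont _)]
    rw [Finset.sum_congr rfl fun σ _ => (hinv a (signVector c σ) (hn σ)).symm]
    simp
  have hle : (Fintype.card (Fin d → Bool × Bool) : ℝ) *
      ∫ U : UnitaryOp d, Real.exp (inner ℂ a ((U : QSpace d →L[ℂ] QSpace d) v)).re ∂μ
      ≤ (Fintype.card (Fin d → Bool × Bool) : ℝ) * Real.exp (‖a‖ ^ 2 * ‖v‖ ^ 2 / (4 * d)) := by
    rw [havg]
    have h1 : ∫ U : UnitaryOp d, ∑ σ : Fin d → Bool × Bool,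
        Real.exp (inner ℂ (signVector c σ) ((U : QSpace d →L[ℂ] QSpace d) v)).re ∂μ
        ≤ ∫ _ : UnitaryOp d, (Fintype.card (Fin d → Bool × Bool) : ℝ) *
          Real.exp (‖a‖ ^ 2 * ‖v‖ ^ 2 / (4 * d)) ∂μ := by
      refine MeasureTheory.integral_mono
        (MeasureTheory.integrable_finsetSum _ fun σ _ => hint _ (hcont _))
        (MeasureTheory.integrable_const _) fun U => ?_
      refine (sum_exp_inner_signVector_le c _).trans (le_of_eq ?_)
      rw [Unitary.norm_map, hc2]
      congr 2
      field_simp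
      ring
    simpa using h1
  exact le_of_mul_le_mul_left hle hN

/-- One unitary that does as well as the average for a weighted sum of exponentials. -/
theorem exists_qunitary_sum_exp_inner_le {d : ℕ} {I : Type*} (s : Finset I) (w : I → ℝ)
    (hw : ∀ i ∈ s, 0 ≤ w i) (a v : I → QSpace d) :
    ∃ U : QUnitary d, ∑ i ∈ s, w i * Real.exp (inner ℂ (a i) (U (v i))).re
      ≤ ∑ i ∈ s, w i * Real.exp (‖a i‖ ^ 2 * ‖v i‖ ^ 2 / (4 * d)) := by
  obtain ⟨m, μ, hμ, hint, hexp⟩ := exists_unitary_measure_exp_inner_le d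
  have hcont : ∀ i, Continuous fun U : UnitaryOp d =>
      w i * Real.exp (inner ℂ (a i) ((U : QSpace d →L[ℂ] QSpace d) (v i))).re := by
    intro i
    refine continuous_const.mul (Real.continuous_exp.comp (Complex.continuous_re.comp ?_))
    refine Continuous.inner continuous_const ?_
    exact (ContinuousLinearMap.apply ℂ (QSpace d) (v i)).continuous.comp continuous_subtype_val
  obtain ⟨U, hU⟩ := MeasureTheory.exists_le_integral (μ := μ)
    (f := fun U : UnitaryOp d => ∑ i ∈ s,
      w i * Real.exp (inner ℂ (a i) ((U : QSpace d →L[ℂ] QSpace d) (v i))).re)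
    (MeasureTheory.integrable_finsetSum _ fun i _ => hint _ (hcont i))
  refine ⟨Unitary.linearIsometryEquiv U, hU.trans ?_⟩
  rw [MeasureTheory.integral_finsetSum _ fun i _ => hint _ (hcont i)]
  refine Finset.sum_le_sum fun i hi => ?_
  rw [MeasureTheory.integral_const_mul]
  exact mul_le_mul_of_nonneg_left (hexp _ _) (hw i hi)

/-- A family of unitaries, chosen one after the other, for a sum of exponentials. -/
theorem exists_qunitary_family_sum_exp_inner_le {d : ℕ} {I : Type*} (s : Finset I) (t : ℕ)
    (w : I → ℝ) (hw : ∀ i ∈ s, 0 ≤ w i) (a : I → Fin t → QSpace d) (v : I → QSpace d) :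
    ∃ U : Fin t → QUnitary d,
      ∑ i ∈ s, w i * Real.exp (∑ k, (inner ℂ (a i k) (U k (v i))).re)
        ≤ ∑ i ∈ s, w i * Real.exp ((∑ k, ‖a i k‖ ^ 2) * ‖v i‖ ^ 2 / (4 * d)) := by
  induction t generalizing w with
  | zero => exact ⟨fun k => k.elim0, by simp⟩
  | succ t ih =>
    obtain ⟨U, hU⟩ := ih
      (fun i => w i * Real.exp (‖a i 0‖ ^ 2 * ‖v i‖ ^ 2 / (4 * d)))
      (fun i hi => mul_nonneg (hw i hi) (Real.exp_pos _).le) (fun i k => a i k.succ)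
    obtain ⟨V, hV⟩ := exists_qunitary_sum_exp_inner_le s
      (fun i => w i * Real.exp (∑ k : Fin t, (inner ℂ (a i k.succ) (U k (v i))).re))
      (fun i hi => mul_nonneg (hw i hi) (Real.exp_pos _).le) (fun i => a i 0) v
    refine ⟨Fin.cons V U, ?_⟩
    calc _ = ∑ i ∈ s, w i * Real.exp (∑ k : Fin t, (inner ℂ (a i k.succ) (U k (v i))).re)
          * Real.exp (inner ℂ (a i 0) (V (v i))).re := by
          refine Finset.sum_congr rfl fun i _ => ?_
          rw [Fin.sum_univ_succ, Real.exp_add]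
          simp only [Fin.cons_zero, Fin.cons_succ]
          ring
      _ ≤ _ := hV
      _ = ∑ i ∈ s, w i * Real.exp (‖a i 0‖ ^ 2 * ‖v i‖ ^ 2 / (4 * d))
          * Real.exp (∑ k : Fin t, (inner ℂ (a i k.succ) (U k (v i))).re) := by
          refine Finset.sum_congr rfl fun i _ => ?_
          ring
      _ ≤ _ := hU
      _ = _ := by
          refine Finset.sum_congr rfl fun i _ => ?_
          rw [Fin.sum_univ_succ, mul_assoc, ← Real.exp_add]
          congr 2
          ring

/-! ### Nets of vectors and of sparse families. -/

/-- The unit ball of a real normed space of dimension `n` has a `1/2`-net with `5 ^ n` points. -/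
theorem exists_half_net (E : Type*) [NormedAddCommGroup E] [NormedSpace ℝ E]
    [FiniteDimensional ℝ E] :
    ∃ N : Finset E, (∀ x ∈ N, ‖x‖ ≤ 1) ∧ N.card ≤ 5 ^ Module.finrank ℝ E ∧
      ∀ x : E, ‖x‖ ≤ 1 → ∃ y ∈ N, ‖x - y‖ ≤ 1 / 2 := by
  classical
  -- A `1/2`-separated subset of the ball of maximal cardinality is a net. Doubling it gives a
  -- 1-separated set in the ball of radius 2, which has at most `5 ^ n` points.
  let P : ℕ → Prop := fun n => ∃ s : Finset E, s.card = n ∧ (∀ x ∈ s, ‖x‖ ≤ 1) ∧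
    ∀ x ∈ s, ∀ y ∈ s, x ≠ y → 1 / 2 ≤ ‖x - y‖
  have hb : ∀ n, P n → n ≤ 5 ^ Module.finrank ℝ E := by
    rintro n ⟨s, rfl, hs1, hs2⟩
    have hinj : Function.Injective fun x : E => (2 : ℝ) • x := smul_right_injective E two_ne_zero
    rw [← Finset.card_image_of_injective s hinj]
    refine Besicovitch.card_le_of_separated _ ?_ ?_
    · intro c hc
      obtain ⟨x, hx, rfl⟩ := Finset.mem_image.mp hc
      rw [norm_smul]
      have := hs1 x hx
      norm_num
      linarith
    · intro c hc e he hne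
      obtain ⟨x, hx, rfl⟩ := Finset.mem_image.mp hc
      obtain ⟨y, hy, rfl⟩ := Finset.mem_image.mp he
      have := hs2 x hx y hy fun h => hne (by rw [h])
      rw [← smul_sub, norm_smul]
      norm_num
      linarith
  have h0 : P 0 := ⟨∅, by simp⟩
  obtain ⟨s, hs, hs1, hs2⟩ := Nat.findGreatest_spec (Nat.zero_le (5 ^ Module.finrank ℝ E)) h0
  refine ⟨s, hs1, hb _ ⟨s, rfl, hs1, hs2⟩, fun x hx => ?_⟩
  by_contra! hcon
  have hxs : x ∉ s := fun h => by
    have := hcon x h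
    simp at this
    linarith
  have hP : P (s.card + 1) := by
    refine ⟨insert x s, Finset.card_insert_of_notMem hxs, ?_, ?_⟩
    · intro y hy
      rcases Finset.mem_insert.mp hy with rfl | hy
      · exact hx
      · exact hs1 y hy
    · intro y hy z hz hyz
      rcases Finset.mem_insert.mp hy with rfl | hy <;> rcases Finset.mem_insert.mp hz with rfl | hz
      · exact absurd rfl hyz
      · exact (hcon z hz).le
      · rw [norm_sub_rev]
        exact (hcon y ‹_›).le
      · exact hs2 y hy z hz hyz
  have := Nat.le_findGreatest (hb _ hP) hP
  omega

theorem finrank_real_euclideanSpace_complex (ι : Type*) [Fintype ι] :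
    Module.finrank ℝ (EuclideanSpace ℂ ι) = 2 * Fintype.card ι := by
  have h := finrank_real_of_complex (EuclideanSpace ℂ ι)
  rw [finrank_euclideanSpace] at h
  exact h

theorem exists_half_net_euclideanSpace_complex (ι : Type*) [Fintype ι] :
    ∃ N : Finset (EuclideanSpace ℂ ι), (∀ x ∈ N, ‖x‖ ≤ 1) ∧ N.card ≤ 25 ^ Fintype.card ι ∧
      ∀ x, ‖x‖ ≤ 1 → ∃ y ∈ N, ‖x - y‖ ≤ 1 / 2 := by
  obtain ⟨N, h1, h2, h3⟩ := exists_half_net (EuclideanSpace ℂ ι)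
  refine ⟨N, h1, h2.trans (le_of_eq ?_), h3⟩
  rw [finrank_real_euclideanSpace_complex, pow_mul]
  norm_num

/-- A vector is bounded by twice its largest inner product with a `1/2`-net. -/
theorem norm_le_two_mul_of_half_net {E : Type*} [NormedAddCommGroup E] [InnerProductSpace ℂ E]
    {N : Set E} (hN : ∀ x : E, ‖x‖ ≤ 1 → ∃ y ∈ N, ‖x - y‖ ≤ 1 / 2) (z : E) {c : ℝ}
    (hc : ∀ x ∈ N, (inner ℂ x z).re ≤ c) : ‖z‖ ≤ 2 * c := by
  rcases eq_or_ne z 0 with rfl | hz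
  · obtain ⟨y, hy, -⟩ := hN 0 (by simp)
    have := hc y hy
    simp at this
    simpa using this
  have hz' : 0 < ‖z‖ := norm_pos_iff.mpr hz
  set x : E := ((‖z‖⁻¹ : ℝ) : ℂ) • z with hx
  have hx1 : ‖x‖ ≤ 1 := by
    rw [hx, norm_smul]
    simp [hz]
  obtain ⟨y, hy, hxy⟩ := hN x hx1
  have h1 : (inner ℂ x z).re = ‖z‖ := by
    rw [hx, inner_smul_left, Complex.conj_ofReal, Complex.re_ofReal_mul,
      show (inner ℂ z z).re = ‖z‖ ^ 2 from inner_self_eq_norm_sq (𝕜 := ℂ) z]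
    field_simp
  have h2 : (inner ℂ x z).re = (inner ℂ y z).re + (inner ℂ (x - y) z).re := by
    rw [← Complex.add_re, ← inner_add_left, add_sub_cancel]
  have h3 : (inner ℂ (x - y) z).re ≤ 1 / 2 * ‖z‖ :=
    ((Complex.re_le_norm _).trans (norm_inner_le_norm _ _)).trans
      (mul_le_mul_of_nonneg_right hxy hz'.le)
  have := hc y hy
  linarith

/-- Extension by zero of a vector supported on a set of pairs, cut into blocks. -/
noncomputable def blockExtend {d t : ℕ} (S : Finset (Fin t × Fin d)) (a : EuclideanSpace ℂ S)
    (k : Fin t) : QSpace d :=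
  WithLp.toLp 2 fun x => if h : (k, x) ∈ S then a ⟨(k, x), h⟩ else 0

theorem sum_sum_dite_mem {α β M : Type*} [Fintype α] [Fintype β] [DecidableEq α] [DecidableEq β]
    [AddCommMonoid M] (S : Finset (α × β)) (f : S → M) :
    ∑ k, ∑ x, (if h : (k, x) ∈ S then f ⟨(k, x), h⟩ else 0) = ∑ p, f p := by
  have h1 : ∑ p, f p = ∑ p : S, (fun q : α × β => if h : q ∈ S then f ⟨q, h⟩ else 0) p := by
    refine Finset.sum_congr rfl fun p _ => ?_
    simp
  rw [h1, Finset.sum_coe_sort S (fun q : α × β => if h : q ∈ S then f ⟨q, h⟩ else 0),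
    ← Fintype.sum_prod_type (fun q : α × β => if h : q ∈ S then f ⟨q, h⟩ else 0)]
  exact (Finset.sum_subset (Finset.subset_univ S) fun q _ hq => by simp [hq]).symm

theorem sum_norm_sq_blockExtend {d t : ℕ} (S : Finset (Fin t × Fin d)) (a : EuclideanSpace ℂ S) :
    ∑ k, ‖blockExtend S a k‖ ^ 2 = ‖a‖ ^ 2 := by
  rw [EuclideanSpace.norm_sq_eq, ← sum_sum_dite_mem]
  refine Finset.sum_congr rfl fun k _ => ?_
  rw [EuclideanSpace.norm_sq_eq]
  refine Finset.sum_congr rfl fun x _ => ?_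
  simp only [blockExtend]
  split_ifs <;> simp

theorem sum_re_inner_blockExtend {d t : ℕ} (S : Finset (Fin t × Fin d)) (a : EuclideanSpace ℂ S)
    (y : Fin t → QSpace d) :
    ∑ k, (inner ℂ (blockExtend S a k) (y k)).re
      = (inner ℂ a (WithLp.toLp 2 fun p : S => y p.1.1 p.1.2)).re := by
  rw [PiLp.inner_apply, Complex.re_sum, ← sum_sum_dite_mem]
  refine Finset.sum_congr rfl fun k _ => ?_
  rw [PiLp.inner_apply, Complex.re_sum]
  refine Finset.sum_congr rfl fun x _ => ?_
  simp only [blockExtend]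
  split_ifs <;> simp

/-- A finite set of test vectors that controls the mass of a family of vectors on every set of
`s` positions. -/
theorem exists_sparse_net (d t s : ℕ) :
    ∃ A : Finset (Fin t → QSpace d), (A.card ≤ (t * d).choose s * 25 ^ s) ∧
      (∀ a ∈ A, ∑ k, ‖a k‖ ^ 2 ≤ 1) ∧
      ∀ (y : Fin t → QSpace d) (c : ℝ), (∀ a ∈ A, ∑ k, (inner ℂ (a k) (y k)).re ≤ c) →
        ∀ S : Finset (Fin t × Fin d), S.card = s → ∑ p ∈ S, ‖y p.1 p.2‖ ^ 2 ≤ (2 * c) ^ 2 := by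
  classical
  choose N hN1 hN2 hN3 using fun S : Finset (Fin t × Fin d) =>
    exists_half_net_euclideanSpace_complex S
  refine ⟨(Finset.powersetCard s Finset.univ).biUnion fun S => (N S).image (blockExtend S),
    ?_, ?_, ?_⟩
  · refine (Finset.card_biUnion_le_card_mul _ _ (25 ^ s) fun S hS => ?_).trans (le_of_eq ?_)
    · refine Finset.card_image_le.trans ((hN2 S).trans (le_of_eq ?_))
      rw [Fintype.card_coe, (Finset.mem_powersetCard.mp hS).2]
    · simp
  · intro a ha
    obtain ⟨S, -, ha⟩ := Finset.mem_biUnion.mp ha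
    obtain ⟨b, hb, rfl⟩ := Finset.mem_image.mp ha
    rw [sum_norm_sq_blockExtend]
    exact pow_le_one₀ (norm_nonneg _) (hN1 S b hb)
  · intro y c hc S hS
    have key := norm_le_two_mul_of_half_net (N := (N S : Set (EuclideanSpace ℂ S)))
      (fun x hx => hN3 S x hx) (WithLp.toLp 2 fun p : S => y p.1.1 p.1.2) (c := c) (by
        intro b hb
        rw [← sum_re_inner_blockExtend]
        refine hc _ (Finset.mem_biUnion.mpr ⟨S, ?_, Finset.mem_image_of_mem _ hb⟩)
        exact Finset.mem_powersetCard.mpr ⟨Finset.subset_univ _, hS⟩)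
    have h2 := pow_le_pow_left₀ (norm_nonneg _) key 2
    rw [EuclideanSpace.norm_sq_eq] at h2
    rwa [← Finset.sum_coe_sort S (fun p => ‖y p.1 p.2‖ ^ 2)]

/-! ### Uniform spreading of all states. -/

/-- A family of unitaries for which the outcome probabilities on any `s` positions add up to at
most `64`. -/
theorem exists_qunitary_family_sum_sq_le {d t s : ℕ}
    (h : ((t * d).choose s * 25 ^ s * 25 ^ d : ℝ) < Real.exp (4 * d)) :
    ∃ U : Fin t → QUnitary d, ∀ ψ : QSpace d, ‖ψ‖ ≤ 1 →
      ∀ S : Finset (Fin t × Fin d), S.card = s → ∑ p ∈ S, ‖U p.1 ψ p.2‖ ^ 2 ≤ 64 := by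
  classical
  rcases Nat.eq_zero_or_pos d with rfl | hd
  · refine ⟨fun _ => LinearIsometryEquiv.refl ℂ _, fun ψ _ S _ => ?_⟩
    have : S = ∅ := Finset.eq_empty_of_forall_notMem fun p => p.2.elim0
    simp [this]
  have hd' : (0 : ℝ) < d := by exact_mod_cast hd
  obtain ⟨A, hA1, hA2, hA3⟩ := exists_sparse_net d t s
  obtain ⟨N, hN1, hN2, hN3⟩ := exists_half_net_euclideanSpace_complex (Fin d)
  rw [Fintype.card_fin] at hN2
  -- With exponential parameter `4 d` each moment is at most `exp ((4 d)² / (4 d)) = exp (4 d)`.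
  -- Fewer than `exp (4 d)` pairs give a sum below `exp (8 d)`, hence every `4 d * ∑ Re ⟨a, U v⟩` is
  -- below `8 d`.
  obtain ⟨U, hU⟩ := exists_qunitary_family_sum_exp_inner_le (A ×ˢ N) t (fun _ => 1)
    (fun _ _ => zero_le_one) (fun i k => i.1 k) (fun i => ((4 * d : ℝ) : ℂ) • i.2)
  have hlt : ∑ i ∈ A ×ˢ N, (1 : ℝ) * Real.exp ((∑ k, ‖i.1 k‖ ^ 2) *
      ‖((4 * d : ℝ) : ℂ) • i.2‖ ^ 2 / (4 * d)) < Real.exp (8 * d) := by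
    have hterm : ∀ i ∈ A ×ˢ N, (1 : ℝ) * Real.exp ((∑ k, ‖i.1 k‖ ^ 2) *
      ‖((4 * d : ℝ) : ℂ) • i.2‖ ^ 2 / (4 * d)) ≤ Real.exp (4 * d) := by
      intro i hi
      obtain ⟨hi1, hi2⟩ := Finset.mem_product.mp hi
      rw [one_mul, Real.exp_le_exp, norm_smul, Complex.norm_real, Real.norm_of_nonneg (by positivity)]
      have e : (∑ k, ‖i.1 k‖ ^ 2) * (4 * d * ‖i.2‖) ^ 2 / (4 * d)
          = (∑ k, ‖i.1 k‖ ^ 2) * ‖i.2‖ ^ 2 * (4 * d : ℝ) := by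
        field_simp
      rw [e]
      have h1 : (∑ k, ‖i.1 k‖ ^ 2) * ‖i.2‖ ^ 2 ≤ 1 :=
        mul_le_one₀ (hA2 _ hi1) (by positivity) (pow_le_one₀ (norm_nonneg _) (hN1 _ hi2))
      nlinarith
    refine (Finset.sum_le_card_nsmul _ _ _ hterm).trans_lt ?_
    rw [nsmul_eq_mul, Finset.card_product]
    have hcard : ((A.card * N.card : ℕ) : ℝ) ≤ (t * d).choose s * 25 ^ s * 25 ^ d := by
      exact_mod_cast Nat.mul_le_mul hA1 hN2
    have e : Real.exp (8 * d) = Real.exp (4 * d) * Real.exp (4 * d) := by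
      rw [← Real.exp_add]; ring_nf
    rw [e]
    exact mul_lt_mul_of_pos_right (hcard.trans_lt h) (Real.exp_pos _)
  have hpt : ∀ a ∈ A, ∀ v ∈ N, ∑ k, (inner ℂ (a k) (U k v)).re ≤ 2 := by
    intro a ha v hv
    have h1 := (Finset.single_le_sum (f := fun i : (Fin t → QSpace d) × QSpace d => (1 : ℝ) *
      Real.exp (∑ k, (inner ℂ (i.1 k) (U k (((4 * d : ℝ) : ℂ) • i.2))).re))
      (fun i _ => by positivity) (Finset.mk_mem_product ha hv)).trans_lt (hU.trans_lt hlt)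
    simp only [one_mul, Real.exp_lt_exp, map_smul, inner_smul_right, Complex.re_ofReal_mul,
      ← Finset.mul_sum] at h1
    nlinarith
  refine ⟨U, fun ψ hψ S hS => ?_⟩
  let T : QSpace d →L[ℂ] EuclideanSpace ℂ S := LinearMap.toContinuousLinearMap
    { toFun := fun ψ => WithLp.toLp 2 fun p : S => U p.1.1 ψ p.1.2
      map_add' := fun x y => by ext p; simp
      map_smul' := fun c x => by ext p; simp }
  have hTs : ∀ ψ, ‖T ψ‖ ^ 2 = ∑ p ∈ S, ‖U p.1 ψ p.2‖ ^ 2 := by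
    intro ψ
    rw [EuclideanSpace.norm_sq_eq, ← Finset.sum_coe_sort S (fun p => ‖U p.1 ψ p.2‖ ^ 2)]
    rfl
  have hTN : ∀ v ∈ N, ‖T v‖ ≤ 4 := by
    intro v hv
    have h1 := hA3 (fun k => U k v) 2 (fun a ha => hpt a ha v hv) S hS
    have h2 : ‖T v‖ ^ 2 ≤ 4 ^ 2 := by
      rw [hTs]
      exact h1.trans (by norm_num)
    exact le_of_sq_le_sq h2 (by norm_num)
  -- The bound 2 on tests became 4 on net states; absorbing `‖T‖ / 2` makes it 8 on all states, and
  -- `64 = 8²`.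
  have hop : ‖T‖ ≤ 4 + ‖T‖ / 2 := by
    refine ContinuousLinearMap.opNorm_le_of_unit_norm (𝕜 := ℂ) (by positivity) fun x hx => ?_
    obtain ⟨v, hv, hxv⟩ := hN3 x hx.le
    have h1 : T x = T v + T (x - v) := by rw [← map_add, add_sub_cancel]
    have h2 : ‖T (x - v)‖ ≤ ‖T‖ / 2 := by
      refine (T.le_opNorm _).trans ?_
      have := mul_le_mul_of_nonneg_left hxv (norm_nonneg T)
      linarith
    rw [h1]
    exact (norm_add_le _ _).trans (add_le_add (hTN v hv) h2)
  have hT8 : ‖T ψ‖ ≤ 8 := by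
    refine (T.le_opNorm ψ).trans ?_
    have := mul_le_mul_of_nonneg_left hψ (norm_nonneg T)
    linarith
  rw [← hTs]
  nlinarith [norm_nonneg (T ψ)]

/-! ### Entropy of outcome distributions. -/

theorem outcomeDist_apply {d : ℕ} (ψ : QSpace d) (x : Fin d) : outcomeDist ψ x = ‖ψ x‖ ^ 2 := by
  simp [outcomeDist, EuclideanSpace.basisFun_apply, EuclideanSpace.inner_single_left]

theorem outcomeDist_nonneg {d : ℕ} (ψ : QSpace d) (x : Fin d) : 0 ≤ outcomeDist ψ x :=
  sq_nonneg _

theorem sum_outcomeDist {d : ℕ} (ψ : QSpace d) : ∑ x, outcomeDist ψ x = ‖ψ‖ ^ 2 := by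
  simp_rw [outcomeDist_apply]
  exact (EuclideanSpace.norm_sq_eq ψ).symm

theorem outcomeDist_le_one {d : ℕ} {ψ : QSpace d} (h : ‖ψ‖ = 1) (x : Fin d) :
    outcomeDist ψ x ≤ 1 := by
  have h1 := sum_outcomeDist ψ
  rw [h, one_pow] at h1
  rw [← h1]
  exact Finset.single_le_sum (fun y _ => outcomeDist_nonneg ψ y) (Finset.mem_univ x)

theorem shannonEntropy_eq_sum {ι : Type*} [Fintype ι] (p : ι → ℝ) :
    shannonEntropy p = ∑ x, p x * (-Real.logb 2 (p x)) := by
  simp [shannonEntropy]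

theorem shannonEntropy_outcomeDist_nonneg {d : ℕ} {ψ : QSpace d} (h : ‖ψ‖ = 1) :
    0 ≤ shannonEntropy (outcomeDist ψ) := by
  rw [shannonEntropy_eq_sum]
  refine Finset.sum_nonneg fun x _ => mul_nonneg (outcomeDist_nonneg ψ x) ?_
  rw [neg_nonneg]
  exact Real.logb_nonpos one_lt_two (outcomeDist_nonneg ψ x) (outcomeDist_le_one h x)

theorem shannonEntropy_outcomeDist_le {d : ℕ} (hd : 0 < d) {ψ : QSpace d} (h : ‖ψ‖ = 1) :
    shannonEntropy (outcomeDist ψ) ≤ Real.logb 2 d := by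
  have hd' : (0 : ℝ) < d := by exact_mod_cast hd
  have hq : 0 < Real.log 2 := Real.log_pos one_lt_two
  have hsum : ∑ x, outcomeDist ψ x = 1 := by rw [sum_outcomeDist, h, one_pow]
  -- Gibbs' inequality against the uniform distribution, termwise from `ln y ≤ y - 1`.
  have hterm : ∀ x, outcomeDist ψ x * (-Real.logb 2 (outcomeDist ψ x))
      ≤ outcomeDist ψ x * Real.logb 2 d + (1 / d - outcomeDist ψ x) / Real.log 2 := by
    intro x
    rcases (outcomeDist_nonneg ψ x).eq_or_lt with h0 | h0
    · rw [← h0]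
      simp only [zero_mul, zero_add, sub_zero]
      positivity
    · have h1 : Real.log (1 / (d * outcomeDist ψ x)) ≤ 1 / (d * outcomeDist ψ x) - 1 :=
        Real.log_le_sub_one_of_pos (by positivity)
      rw [Real.log_div one_ne_zero (by positivity), Real.log_one,
        Real.log_mul hd'.ne' h0.ne'] at h1
      have h2 := mul_le_mul_of_nonneg_left h1 h0.le
      have h3 : outcomeDist ψ x * (1 / (d * outcomeDist ψ x) - 1) = 1 / d - outcomeDist ψ x := by
        field_simp
      rw [h3] at h2
      have h4 := div_le_div_of_nonneg_right h2 hq.le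
      simp only [Real.logb]
      have h5 : outcomeDist ψ x * (0 - (Real.log d + Real.log (outcomeDist ψ x))) / Real.log 2
          = outcomeDist ψ x * (-(Real.log (outcomeDist ψ x) / Real.log 2))
            - outcomeDist ψ x * (Real.log d / Real.log 2) := by
        field_simp
        ring
      linarith
  rw [shannonEntropy_eq_sum]
  refine (Finset.sum_le_sum fun x _ => hterm x).trans (le_of_eq ?_)
  rw [Finset.sum_add_distrib, ← Finset.sum_mul, ← Finset.sum_div, Finset.sum_sub_distrib, hsum]
  simp [hd'.ne']

theorem avgMeasurementEntropy_nonneg {d t : ℕ} (U : Fin t → QUnitary d) {ψ : QSpace d}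
    (h : ‖ψ‖ = 1) : 0 ≤ avgMeasurementEntropy U ψ :=
  mul_nonneg (by positivity) (Finset.sum_nonneg fun k _ =>
    shannonEntropy_outcomeDist_nonneg (by rw [LinearIsometryEquiv.norm_map, h]))

theorem avgMeasurementEntropy_le {d t : ℕ} (hd : 0 < d) (ht : 0 < t) (U : Fin t → QUnitary d)
    {ψ : QSpace d} (h : ‖ψ‖ = 1) : avgMeasurementEntropy U ψ ≤ Real.logb 2 d := by
  have ht' : (0 : ℝ) < t := by exact_mod_cast ht
  have h1 : ∑ k, shannonEntropy (outcomeDist (U k ψ)) ≤ ∑ _k : Fin t, Real.logb 2 d :=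
    Finset.sum_le_sum fun k _ =>
      shannonEntropy_outcomeDist_le hd (by rw [LinearIsometryEquiv.norm_map, h])
  rw [Finset.sum_const, Finset.card_univ, Fintype.card_fin, nsmul_eq_mul] at h1
  rw [avgMeasurementEntropy, one_div, inv_mul_le_iff₀ ht']
  exact h1

/-- If any `s` outcomes carry total probability at most `M`, the average entropy is large. -/
theorem le_avgMeasurementEntropy {d t s : ℕ} {M : ℝ} (ht : 0 < t) (hs : 0 < s) (hM : 0 < M)
    (hst : s ≤ t * d) (hMs : M ≤ s) (U : Fin t → QUnitary d) {ψ : QSpace d} (h : ‖ψ‖ = 1)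
    (hU : ∀ S : Finset (Fin t × Fin d), S.card = s → ∑ p ∈ S, ‖U p.1 ψ p.2‖ ^ 2 ≤ M) :
    (1 - M / t) * Real.logb 2 (s / M) ≤ avgMeasurementEntropy U ψ := by
  classical
  have ht' : (0 : ℝ) < t := by exact_mod_cast ht
  have hs' : (0 : ℝ) < s := by exact_mod_cast hs
  have hnorm : ∀ k, ‖U k ψ‖ = 1 := fun k => by rw [LinearIsometryEquiv.norm_map, h]
  set q : Fin t × Fin d → ℝ := fun p => outcomeDist (U p.1 ψ) p.2 with hq
  have hq0 : ∀ p, 0 ≤ q p := fun p => outcomeDist_nonneg _ _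
  have hq1 : ∀ p, q p ≤ 1 := fun p => outcomeDist_le_one (hnorm _) _
  have hqU : ∀ S : Finset (Fin t × Fin d), S.card = s → ∑ p ∈ S, q p ≤ M := by
    intro S hS
    simpa only [hq, outcomeDist_apply] using hU S hS
  have hl : 0 ≤ Real.logb 2 (s / M) := by
    refine Real.logb_nonneg one_lt_two ?_
    rwa [one_le_div hM]
  set B : Finset (Fin t × Fin d) := Finset.univ.filter fun p => M / s < q p with hB
  have hBs : B.card < s := by
    by_contra! hcon
    obtain ⟨S, hSB, hS⟩ := Finset.exists_subset_card_eq hcon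
    have hne : S.Nonempty := Finset.card_pos.mp (by omega)
    have h1 : ∑ _p ∈ S, M / s < ∑ p ∈ S, q p :=
      Finset.sum_lt_sum_of_nonempty hne fun p hp => (Finset.mem_filter.mp (hSB hp)).2
    rw [Finset.sum_const, hS, nsmul_eq_mul, mul_div_cancel₀ _ hs'.ne'] at h1
    exact absurd (hqU S hS) (not_le.mpr h1)
  -- `B` is enlarged to exactly `s` positions, where the hypothesis applies.
  have hBM : ∑ p ∈ B, q p ≤ M := by
    obtain ⟨S, hBS, hS⟩ := Finset.exists_superset_card_eq hBs.le (by simpa using hst)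
    exact (Finset.sum_le_sum_of_subset_of_nonneg hBS fun p _ _ => hq0 p).trans (hqU S hS)
  have hall : ∑ p, q p = t := by
    rw [Fintype.sum_prod_type]
    simp only [hq, sum_outcomeDist, hnorm]
    simp
  have hsplit := Finset.sum_add_sum_compl B q
  have hent : ∑ k, shannonEntropy (outcomeDist (U k ψ)) = ∑ p, q p * (-Real.logb 2 (q p)) := by
    rw [Fintype.sum_prod_type]
    exact Finset.sum_congr rfl fun k _ => shannonEntropy_eq_sum _
  have hlow : ∑ p ∈ Bᶜ, q p * Real.logb 2 (s / M) ≤ ∑ p, q p * (-Real.logb 2 (q p)) := by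
    refine (Finset.sum_le_sum fun p hp => ?_).trans
      (Finset.sum_le_sum_of_subset_of_nonneg (Finset.subset_univ Bᶜ) fun p _ _ =>
        mul_nonneg (hq0 p) (neg_nonneg.mpr (Real.logb_nonpos one_lt_two (hq0 p) (hq1 p))))
    have hp' : q p ≤ M / s := by
      by_contra! hc
      exact Finset.mem_compl.mp hp (Finset.mem_filter.mpr ⟨Finset.mem_univ _, hc⟩)
    rcases (hq0 p).eq_or_lt with h0 | h0
    · simp [← h0]
    · refine mul_le_mul_of_nonneg_left ?_ h0.le
      rw [le_neg, ← Real.logb_inv, inv_div]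
      exact Real.logb_le_logb_of_le one_lt_two h0 hp'
  rw [← Finset.sum_mul] at hlow
  rw [avgMeasurementEntropy, hent, one_div, ← div_eq_inv_mul, le_div_iff₀ ht']
  refine le_trans ?_ hlow
  have e : (1 - M / t) * Real.logb 2 (s / M) * t = (t - M) * Real.logb 2 (s / M) := by
    field_simp
  rw [e]
  exact mul_le_mul_of_nonneg_right (by linarith) hl

/-! ### Counting the test pairs. -/

/-- From `2 ^ 19 ≤ 3 ^ 12` and `3 ^ 5 ≤ 2 ^ 8`. -/
theorem log_three_mem_bounds : 19 / 12 ≤ Real.logb 2 3 ∧ Real.logb 2 3 ≤ 8 / 5 := by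
  constructor
  · rw [Real.le_logb_iff_rpow_le one_lt_two (by norm_num)]
    refine le_of_pow_le_pow_left₀ (n := 12) (by norm_num) (by norm_num) ?_
    rw [← Real.rpow_natCast, ← Real.rpow_mul (by norm_num)]
    norm_num
  · rw [Real.logb_le_iff_le_rpow one_lt_two (by norm_num)]
    refine le_of_pow_le_pow_left₀ (n := 5) (by norm_num) (by positivity) ?_
    rw [← Real.rpow_natCast (2 ^ (8 / 5 : ℝ)), ← Real.rpow_mul (by norm_num)]
    norm_num

theorem log_three_le : Real.log 3 ≤ 1.1092 := by
  have h := log_three_mem_bounds.2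
  rw [Real.logb, div_le_iff₀ (Real.log_pos one_lt_two)] at h
  have := Real.log_two_lt_d9
  linarith

theorem log_twentyFive_le : Real.log 25 ≤ 3.235 := by
  have h : 3 * Real.log 25 ≤ 14 * Real.log 2 := by
    rw [show (3 : ℝ) = (3 : ℕ) by norm_num, show (14 : ℝ) = (14 : ℕ) by norm_num,
      ← Real.log_pow, ← Real.log_pow]
    exact Real.log_le_log (by norm_num) (by norm_num)
  have := Real.log_two_lt_d9
  linarith

/-- The usual bound `(e n / s) ^ s`, from `s ^ s / s! ≤ e ^ s`. -/
theorem choose_le_exp {n s : ℕ} (hn : 0 < n) (hs : 0 < s) :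
    (n.choose s : ℝ) ≤ Real.exp (s * (Real.log (n / s) + 1)) := by
  have hs' : (0 : ℝ) < s := by exact_mod_cast hs
  have hn' : (0 : ℝ) < n := by exact_mod_cast hn
  have hf : (0 : ℝ) < s.factorial := by exact_mod_cast s.factorial_pos
  have h1 := Real.pow_div_factorial_le_exp _ hs'.le s
  have e : Real.exp (s * (Real.log (n / s) + 1)) = (n / s) ^ s * Real.exp s := by
    rw [mul_add, mul_one, Real.exp_add, Real.exp_nat_mul, Real.exp_log (by positivity)]
  rw [e]
  calc (n.choose s : ℝ) ≤ n ^ s / s.factorial := Nat.choose_le_pow_div s n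
    _ = (n / s) ^ s * (s ^ s / s.factorial) := by
        rw [div_pow]
        field_simp
    _ ≤ _ := mul_le_mul_of_nonneg_left h1 (by positivity)

theorem sq_logb_two_le {t : ℝ} (ht : 1 ≤ t) : Real.logb 2 t ^ 2 ≤ 3 * t := by
  have h0 : 0 < t := by linarith
  have hs : 0 < Real.sqrt t := Real.sqrt_pos.mpr h0
  have h1 := Real.log_le_sub_one_of_pos (x := Real.sqrt t / 2) (by positivity)
  rw [Real.log_div hs.ne' two_ne_zero, Real.log_sqrt h0.le] at h1
  have hq := Real.log_two_gt_d9
  have hq' := Real.log_two_lt_d9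
  have h2 : Real.log t ≤ Real.sqrt t := by linarith
  have h3 : 0 ≤ Real.log t := Real.log_nonneg ht
  have h4 : Real.log t ^ 2 ≤ t := by
    calc Real.log t ^ 2 ≤ Real.sqrt t ^ 2 := pow_le_pow_left₀ h3 h2 2
      _ = t := Real.sq_sqrt h0.le
  rw [Real.logb, div_pow, div_le_iff₀ (by positivity)]
  have h5 : 1 / 3 ≤ Real.log 2 ^ 2 := by nlinarith
  nlinarith

/-- The number of positions for which the counting argument applies. -/
theorem exists_card_choose_mul_pow_lt {d t : ℕ} (hL : 9 ≤ Real.logb 2 t) (ht : 0 < t)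
    (htd : 128 * t / Real.logb 2 t ≤ d) :
    ∃ s : ℕ, 0 < s ∧ s ≤ t * d ∧ d / (3 * Real.logb 2 t) ≤ s ∧
      ((t * d).choose s * 25 ^ s * 25 ^ d : ℝ) < Real.exp (4 * d) := by
  have ht' : (1 : ℝ) ≤ t := by exact_mod_cast ht
  set L := Real.logb 2 t with hLdef
  have hL0 : 0 < L := by linarith
  have hsq : L ^ 2 ≤ 3 * t := sq_logb_two_le ht'
  rw [div_le_iff₀ hL0] at htd
  have hd15 : 15 * L ≤ d := by
    by_contra! hc
    nlinarith
  have hd' : (0 : ℝ) < d := by nlinarith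
  have hdpos : 0 < d := by exact_mod_cast hd'
  -- Since `2/5 = 1/3 + 1/15` and `d ≥ 15 L`, rounding down still leaves `d / (3 L)`. The factor
  -- `2/5` is small enough for the count: its logarithm is at most `(0.62 + 3.235) d < 4 d`.
  set s := ⌊2 * (d : ℝ) / (5 * L)⌋₊ with hs
  have hs1 : (s : ℝ) ≤ 2 * d / (5 * L) := Nat.floor_le (by positivity)
  have hs2 : 2 * (d : ℝ) / (5 * L) < s + 1 := Nat.lt_floor_add_one _
  have hs3 : d / (3 * L) ≤ s := by
    have h1 : 1 ≤ d / (15 * L) := by rwa [one_le_div (by positivity)]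
    have h2 : 2 * (d : ℝ) / (5 * L) = d / (3 * L) + d / (15 * L) := by field_simp; norm_num
    linarith
  have hs0 : (0 : ℝ) < s := lt_of_lt_of_le (by positivity) hs3
  have hspos : 0 < s := by exact_mod_cast hs0
  refine ⟨s, hspos, ?_, hs3, ?_⟩
  · have h1 : 2 * (d : ℝ) / (5 * L) ≤ d := by
      rw [div_le_iff₀ (by positivity)]
      nlinarith
    have h2 : s ≤ d := by exact_mod_cast hs1.trans h1
    exact h2.trans (Nat.le_mul_of_pos_left d ht)
  · have hc := choose_le_exp (n := t * d) (s := s) (by positivity) hspos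
    have e25 : ∀ n : ℕ, (25 : ℝ) ^ n = Real.exp (n * Real.log 25) := by
      intro n
      rw [Real.exp_nat_mul, Real.exp_log (by norm_num)]
    have hlog : Real.log ((t * d : ℕ) / s) ≤ Real.log 3 + L * Real.log 2 + Real.log L := by
      have h1 : Real.log (3 * t * L) = Real.log 3 + L * Real.log 2 + Real.log L := by
        rw [Real.log_mul (by positivity) hL0.ne', Real.log_mul (by norm_num) (by positivity),
          hLdef, Real.logb, div_mul_cancel₀ _ (Real.log_pos one_lt_two).ne']
      rw [← h1]
      refine Real.log_le_log (by positivity) ?_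
      rw [div_le_iff₀ hs0]
      rw [div_le_iff₀ (by positivity)] at hs3
      push_cast
      nlinarith
    have hlogL : Real.log L ≤ 2 * Real.log 3 + (L / 9 - 1) := by
      have h1 := Real.log_le_sub_one_of_pos (x := L / 9) (by positivity)
      rw [Real.log_div hL0.ne' (by norm_num), show (9 : ℝ) = 3 ^ 2 by norm_num,
        Real.log_pow] at h1
      push_cast at h1
      linarith
    have hq := Real.log_two_lt_d9
    have h3 := log_three_le
    have h25 := log_twentyFive_le
    have hQ : Real.log ((t * d : ℕ) / s) + 1 + Real.log 25 ≤ 1.54 * L := by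
      have : L * Real.log 2 ≤ L * 0.6931471808 := mul_le_mul_of_nonneg_left hq.le hL0.le
      linarith
    have hsQ : s * (Real.log ((t * d : ℕ) / s) + 1 + Real.log 25) ≤ 0.62 * d := by
      refine (mul_le_mul_of_nonneg_left hQ hs0.le).trans ?_
      rw [le_div_iff₀ (by positivity)] at hs1
      nlinarith
    calc ((t * d).choose s * 25 ^ s * 25 ^ d : ℝ)
        ≤ Real.exp (s * (Real.log ((t * d : ℕ) / s) + 1)) * 25 ^ s * 25 ^ d := by gcongr
      _ = Real.exp (s * (Real.log ((t * d : ℕ) / s) + 1 + Real.log 25) + d * Real.log 25) := by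
          rw [e25, e25, ← Real.exp_add, ← Real.exp_add]
          ring_nf
      _ < Real.exp (4 * d) := by
          rw [Real.exp_lt_exp]
          nlinarith

/-! ### Comparison with the target bound. -/

/-- A tangent line bound for `2 ^ (-u)` at a half-integer. -/
theorem le_two_rpow_neg (n : ℕ) {u : ℝ} (h1 : u ≤ n + 5 / 2)
    (h2 : 0 ≤ 0.9998 - 0.6931 * (u - n - 1 / 2)) :
    -- The value 0.9998 instead of 1 absorbs the rounding of `log 2` to 0.6931, as the offset `u - n
    -- - 1/2` is at most 2.
    0.707 * (1 / 2) ^ n * (0.9998 - 0.6931 * (u - n - 1 / 2)) ≤ (2 : ℝ) ^ (-u) := by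
  have hq := Real.log_two_gt_d9
  have hq' := Real.log_two_lt_d9
  have e : (2 : ℝ) ^ (-u) = 2 ^ (-(1 / 2 : ℝ)) * (1 / 2) ^ n * 2 ^ (-(u - n - 1 / 2)) := by
    rw [one_div, inv_pow, ← Real.rpow_natCast, ← Real.rpow_neg two_pos.le, ← Real.rpow_add two_pos,
      ← Real.rpow_add two_pos]
    congr 1
    ring
  have hr : (0.707 : ℝ) ≤ 2 ^ (-(1 / 2 : ℝ)) := by
    refine le_of_pow_le_pow_left₀ (n := 2) (by norm_num) (by positivity) ?_
    rw [← Real.rpow_natCast (2 ^ (-(1 / 2 : ℝ))), ← Real.rpow_mul (by norm_num)]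
    norm_num
  have hx : 0.9998 - 0.6931 * (u - n - 1 / 2) ≤ (2 : ℝ) ^ (-(u - n - 1 / 2)) := by
    rw [Real.rpow_def_of_pos two_pos]
    have h4 := Real.add_one_le_exp (Real.log 2 * -(u - n - 1 / 2))
    refine le_trans ?_ h4
    nlinarith [mul_nonneg (sub_nonneg.mpr h1) (sub_nonneg.mpr hq.le)]
  rw [e]
  gcongr

/-- This is what the case `ε < 1` reduces to, with `ε = 2 ^ (-u)`. The tangents at 1/2, 3/2 and 5/2
cover `u ≤ 3.85`; beyond that `1.8 * u` suffices. -/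
theorem exp_tradeoff_le {u : ℝ} (hu : 0 ≤ u) :
    6.83 ≤ (2 : ℝ) ^ (-u) * (8 / 9 * (13 + 2 * u) - 2 * Real.log 2 * (1 - u)) + 1.8 * u := by
  have hq := Real.log_two_gt_d9
  have hq' := Real.log_two_lt_d9
  have he : 0 < (2 : ℝ) ^ (-u) := by positivity
  have hcoef : u ≤ 1 → 10 + 3 * u ≤ 8 / 9 * (13 + 2 * u) - 2 * Real.log 2 * (1 - u) := by
    intro h
    nlinarith
  have hcoef' : 1 ≤ u →
      8 / 9 * (13 + 2 * u) ≤ 8 / 9 * (13 + 2 * u) - 2 * Real.log 2 * (1 - u) := by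
    intro h
    nlinarith
  rcases le_total u 1 with h1 | h1
  · have h := le_two_rpow_neg 0 (u := u) (by norm_num; linarith) (by norm_num; linarith)
    have h2 := mul_le_mul h (hcoef h1) (by linarith) he.le
    refine le_trans ?_ (add_le_add h2 le_rfl)
    norm_num
    nlinarith [mul_nonneg hu (sub_nonneg.mpr h1)]
  have h0 := mul_le_mul_of_nonneg_left (hcoef' h1) he.le
  refine le_trans ?_ (add_le_add h0 le_rfl)
  rcases le_total u 2 with h2 | h2
  · have h := le_two_rpow_neg 1 (u := u) (by norm_num; linarith) (by norm_num; linarith)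
    have h3 := mul_le_mul_of_nonneg_right h (by linarith : 0 ≤ 8 / 9 * (13 + 2 * u))
    refine le_trans ?_ (add_le_add h3 le_rfl)
    norm_num
    nlinarith [mul_nonneg (sub_nonneg.mpr h1) (sub_nonneg.mpr h2)]
  rcases le_total u 3.85 with h3 | h3
  · have h := le_two_rpow_neg 2 (u := u) (by norm_num; linarith) (by norm_num; linarith)
    have h4 := mul_le_mul_of_nonneg_right h (by linarith : 0 ≤ 8 / 9 * (13 + 2 * u))
    refine le_trans ?_ (add_le_add h4 le_rfl)
    norm_num
    nlinarith [mul_nonneg (sub_nonneg.mpr h2) (sub_nonneg.mpr h3)]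
  · have : 0 ≤ (2 : ℝ) ^ (-u) * (8 / 9 * (13 + 2 * u)) := by positivity
    linarith

theorem logb_two_sixtyFour_mul_div {t L : ℝ} (ht : 0 < t) (hL : 0 < L) :
    Real.logb 2 (64 * L / t) = 6 + Real.logb 2 L - Real.logb 2 t := by
  rw [Real.logb_div (by positivity) ht.ne', Real.logb_mul (by norm_num) hL.ne',
    show (64 : ℝ) = 2 ^ (6 : ℝ) by norm_num, Real.logb_rpow two_pos (by norm_num)]

theorem logb_two_sqrt_sixtyFour_mul_div {t L : ℝ} (ht : 0 < t) (hL : 0 < L) :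
    2 * Real.logb 2 (Real.sqrt (64 * L / t)) = 6 + Real.logb 2 L - Real.logb 2 t := by
  rw [← logb_two_sixtyFour_mul_div ht hL, Real.logb, Real.logb,
    Real.log_sqrt (by positivity : 0 ≤ 64 * L / t)]
  ring

theorem logb_two_eighteen_mul_div {t L : ℝ} (ht : 0 < t) (hL : 0 < L) :
    Real.logb 2 (18 * t / (64 * L))
      = 1 + 2 * Real.logb 2 3 - (6 + Real.logb 2 L - Real.logb 2 t) := by
  rw [← logb_two_sixtyFour_mul_div ht hL, show 18 * t / (64 * L) = 2 * 3 ^ 2 / (64 * L / t) by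
    field_simp; norm_num, Real.logb_div (by norm_num) (by positivity),
    Real.logb_mul (by norm_num) (by norm_num), Real.logb_self_eq_one one_lt_two, Real.logb_pow]
  norm_num

theorem logb_two_lower_of_le {t L d : ℝ} (ht : 0 < t) (hL : 0 < L) (hd : 128 * t / L ≤ d) :
    7 + Real.logb 2 t - Real.logb 2 L ≤ Real.logb 2 d := by
  have h := Real.logb_le_logb_of_le one_lt_two (by positivity : 0 < 128 * t / L) hd
  rwa [Real.logb_div (by positivity) hL.ne', Real.logb_mul (by norm_num) ht.ne',
    show (128 : ℝ) = 2 ^ (7 : ℝ) by norm_num, Real.logb_rpow two_pos (by norm_num)] at h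

theorem etaFn_eq {ε : ℝ} (hε : 0 < ε) :
    etaFn ε = -2 * ε * (Real.log 2 * (1 + Real.logb 2 ε)) := by
  rw [etaFn, Real.log_mul two_ne_zero hε.ne', Real.logb]
  field_simp

/-- The target loses `ε log d`, the proved bound only `(64 / t) log d ≤ (ε / 9) log d`. As `log d ≥
13 + 2 u` for `u = -log ε`, the remaining `(8/9) ε log d` pays for the other terms. -/
theorem entropy_target_le_of_lt_one {t d : ℝ} (ht : 0 < t) (hL : 9 ≤ Real.logb 2 t)
    (hd : 128 * t / Real.logb 2 t ≤ d) (hε : 64 * Real.logb 2 t / t < 1) :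
    (1 - Real.sqrt (64 * Real.logb 2 t / t)) * Real.logb 2 d
        - Real.logb 2 (18 * t / (64 * Real.logb 2 t))
        - etaFn (Real.sqrt (64 * Real.logb 2 t / t))
      ≤ Real.logb 2 d - Real.logb 2 (192 * Real.logb 2 t) - 64 / t * Real.logb 2 d := by
  have hL0 : 0 < Real.logb 2 t := by linarith
  have hD := logb_two_lower_of_le ht hL0 hd
  have hy := logb_two_sqrt_sixtyFour_mul_div ht hL0
  have hε0 : 0 < Real.sqrt (64 * Real.logb 2 t / t) := Real.sqrt_pos.mpr (by positivity)
  have hsq : Real.sqrt (64 * Real.logb 2 t / t) ^ 2 = 64 * Real.logb 2 t / t :=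
    Real.sq_sqrt (by positivity)
  rw [logb_two_eighteen_mul_div ht hL0, etaFn_eq hε0]
  set L := Real.logb 2 t with hLdef
  set ε := Real.sqrt (64 * L / t) with hεdef
  set D := Real.logb 2 d
  set u := -Real.logb 2 ε with hu
  have hε1 : ε < 1 := by
    rw [hεdef, Real.sqrt_lt' one_pos]
    simpa using hε
  have hεu : (2 : ℝ) ^ (-u) = ε := by
    rw [hu, neg_neg, Real.rpow_logb two_pos (by norm_num) hε0]
  have hu0 : 0 ≤ u := by
    rw [hu, neg_nonneg]
    exact Real.logb_nonpos one_lt_two hε0.le hε1.le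
  have hmain := exp_tradeoff_le hu0
  rw [hεu] at hmain
  have hq := Real.log_two_gt_d9
  have h192 : Real.logb 2 (192 * L) = 6 + Real.logb 2 3 + Real.logb 2 L := by
    rw [show 192 * L = 2 ^ (6 : ℝ) * 3 * L by norm_num, Real.logb_mul (by positivity) hL0.ne',
      Real.logb_mul (by positivity) (by norm_num), Real.logb_rpow two_pos (by norm_num)]
  have hℓ0 : 0 ≤ Real.logb 2 L := Real.logb_nonneg one_lt_two (by linarith)
  -- Tangent to the logarithm at 16; with `L = 6 + 2 u + ℓ` it bounds `ℓ` linearly in `u`.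
  have hℓ : Real.log 2 * (Real.logb 2 L - 4) ≤ L / 16 - 1 := by
    have h1 := Real.log_le_sub_one_of_pos (x := L / 16) (by positivity)
    rw [Real.log_div hL0.ne' (by norm_num), show (16 : ℝ) = 2 ^ 4 by norm_num, Real.log_pow] at h1
    have h2 : Real.log 2 * Real.logb 2 L = Real.log L := by
      rw [Real.logb]
      field_simp
    rw [mul_sub, h2]
    push_cast at h1
    linarith
  have h64 : 64 / t ≤ ε / 9 := by
    have h1 : 64 / t * L = ε ^ 2 := by rw [hsq]; ring
    have h2 : 0 < 64 / t := by positivity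
    nlinarith
  set ℓ := Real.logb 2 L
  have hLu : L = 6 + 2 * u + ℓ := by linarith
  have hq' := Real.log_two_lt_d9
  have hℓu : ℓ ≤ 3.41 + 0.2 * u := by
    rw [hLu] at hℓ
    nlinarith [mul_nonneg hℓ0 (sub_nonneg.mpr hq.le)]
  have h3 := log_three_mem_bounds.1
  have hDu : 13 + 2 * u ≤ D := by linarith
  have hDmul : ε * (8 / 9) * (13 + 2 * u) ≤ (ε - 64 / t) * D := by
    refine mul_le_mul (by linarith) hDu (by linarith) (by linarith)
  rw [h192]
  have hlu : Real.logb 2 ε = -u := by rw [hu, neg_neg]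
  rw [hlu]
  nlinarith

theorem entropy_target_nonpos_of_one_le {t d : ℝ} (ht : 1 < t)
    (hd : 128 * t / Real.logb 2 t ≤ d) (hε : 1 ≤ 64 * Real.logb 2 t / t) :
    (1 - Real.sqrt (64 * Real.logb 2 t / t)) * Real.logb 2 d
        - Real.logb 2 (18 * t / (64 * Real.logb 2 t))
        - etaFn (Real.sqrt (64 * Real.logb 2 t / t)) ≤ 0 := by
  have ht0 : 0 < t := by linarith
  have hL0 : 0 < Real.logb 2 t := Real.logb_pos one_lt_two ht
  have hD := logb_two_lower_of_le ht0 hL0 hd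
  have hy := logb_two_sqrt_sixtyFour_mul_div ht0 hL0
  have hε1 : 1 ≤ Real.sqrt (64 * Real.logb 2 t / t) := Real.one_le_sqrt.mpr hε
  have hε0 : 0 < Real.sqrt (64 * Real.logb 2 t / t) := by linarith
  have hq := Real.log_two_gt_d9
  have hq' := Real.log_two_lt_d9
  -- From `ln t ≤ t / e`.
  have hε6 : Real.sqrt (64 * Real.logb 2 t / t) ≤ 6 := by
    refine Real.sqrt_le_iff.mpr ⟨by norm_num, ?_⟩
    rw [div_le_iff₀ ht0]
    have h1 := Real.log_le_sub_one_of_pos (x := t / Real.exp 1) (by positivity)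
    rw [Real.log_div ht0.ne' (Real.exp_pos 1).ne', Real.log_exp] at h1
    have h2 : t / Real.exp 1 ≤ 0.38 * t := by
      rw [div_le_iff₀ (Real.exp_pos 1)]
      have := Real.exp_one_gt_d9
      nlinarith
    have h3 : Real.logb 2 t * Real.log 2 = Real.log t := by
      rw [Real.logb, div_mul_cancel₀ _ (Real.log_pos one_lt_two).ne']
    nlinarith
  rw [logb_two_eighteen_mul_div ht0 hL0, etaFn_eq hε0]
  set ε := Real.sqrt (64 * Real.logb 2 t / t)
  have hyexp : Real.logb 2 ε * Real.log 2 ≤ ε - 1 := by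
    rw [Real.logb, div_mul_cancel₀ _ (Real.log_pos one_lt_two).ne']
    exact Real.log_le_sub_one_of_pos hε0
  have hy0 : 0 ≤ Real.logb 2 ε := Real.logb_nonneg one_lt_two hε1
  have hpow : ∀ x : ℝ, 0 < x → ε ≤ x → Real.logb 2 ε ≤ Real.logb 2 x := fun x _ hx =>
    Real.logb_le_logb_of_le one_lt_two hε0 hx
  have h3 := log_three_mem_bounds
  have h4 : Real.logb 2 4 = 2 := by
    rw [show (4 : ℝ) = 2 ^ (2 : ℝ) by norm_num, Real.logb_rpow two_pos (by norm_num)]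
  have h6 : Real.logb 2 6 ≤ 2.6 := by
    rw [show (6 : ℝ) = 2 * 3 by norm_num, Real.logb_mul two_ne_zero three_ne_zero,
      Real.logb_self_eq_one one_lt_two]
    linarith [h3.2]
  set y := Real.logb 2 ε
  have hDy : 13 - 2 * y ≤ Real.logb 2 d := by linarith
  have hDmul : (1 - ε) * Real.logb 2 d ≤ (1 - ε) * (13 - 2 * y) :=
    mul_le_mul_of_nonpos_left hDy (by linarith)
  have hη : 2 * ε * (Real.log 2 * (1 + y)) ≤ 1.3863 * (ε * (1 + y)) := by
    nlinarith [mul_nonneg hε0.le (by linarith : 0 ≤ 1 + y)]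
  have hfin : 8.84 - 11.6137 * ε + 3.3863 * (ε * y) ≤ 0 := by
    rcases le_total ε 2 with h2 | h2
    · have : y ≤ 1.45 * (ε - 1) := by nlinarith
      nlinarith
    rcases le_total ε 4 with h5 | h5
    · have := hpow 4 (by norm_num) h5
      nlinarith
    · have := hpow 6 (by norm_num) hε6
      nlinarith
  nlinarith [h3.1]

/-! ### The relation in fixed dimension. -/

/-- Bootstrapping: each lower bound 1, 6, 8 on `log t` enlarges `t > 64 log t`, which yields the
next, up to 9. -/
theorem nine_le_logb_two_of_mul_lt {t : ℕ} (ht : 2 < t) (h : 64 * Real.logb 2 t < t) :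
    9 ≤ Real.logb 2 t := by
  have ht0 : (0 : ℝ) < t := by exact_mod_cast (by omega : 0 < t)
  have step : ∀ n : ℕ, (2 : ℝ) ^ n ≤ t → (n : ℝ) ≤ Real.logb 2 t := by
    intro n hn
    rw [Real.le_logb_iff_rpow_le one_lt_two ht0, Real.rpow_natCast]
    exact hn
  have h1 := step 1 (by norm_num; exact_mod_cast ht.le)
  have h2 := step 6 (by push_cast at h1; linarith)
  have h3 := step 8 (by push_cast at h2; linarith)
  have h4 := step 9 (by push_cast at h3; linarith)
  exact_mod_cast h4

theorem exists_qunitary_family_avgMeasurementEntropy {d t : ℕ} (ht : 2 < t)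
    (hd : 128 * (t : ℝ) / Real.logb 2 t ≤ d) :
    ∃ U : Fin t → QUnitary d, ∀ ψ : QSpace d, ‖ψ‖ = 1 →
      (1 - Real.sqrt (64 * Real.logb 2 t / t)) * Real.logb 2 d
          - Real.logb 2 (18 * t / (64 * Real.logb 2 t))
          - etaFn (Real.sqrt (64 * Real.logb 2 t / t))
        ≤ avgMeasurementEntropy U ψ := by
  have ht0 : 0 < t := by omega
  have ht0' : (0 : ℝ) < t := by exact_mod_cast ht0
  have ht1 : (1 : ℝ) < t := by exact_mod_cast (by omega : 1 < t)
  rcases le_or_gt 1 (64 * Real.logb 2 (t : ℝ) / t) with hε | hε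
  · exact ⟨fun _ => LinearIsometryEquiv.refl ℂ _, fun ψ hψ =>
      (entropy_target_nonpos_of_one_le ht1 hd hε).trans (avgMeasurementEntropy_nonneg _ hψ)⟩
  have hL : 9 ≤ Real.logb 2 (t : ℝ) :=
    nine_le_logb_two_of_mul_lt ht (by rwa [div_lt_one ht0'] at hε)
  have hL0 : 0 < Real.logb 2 (t : ℝ) := by linarith
  have ht64 : 64 / (t : ℝ) ≤ 1 := by
    rw [div_lt_one ht0'] at hε
    rw [div_le_one ht0']
    nlinarith
  have hd1 : (1 : ℝ) ≤ d := by
    refine le_trans ?_ hd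
    rw [le_div_iff₀ hL0]
    rw [div_lt_one ht0'] at hε
    linarith
  have htarget := entropy_target_le_of_lt_one ht0' hL hd hε
  have hD0 : 0 ≤ Real.logb 2 (d : ℝ) := Real.logb_nonneg one_lt_two hd1
  obtain ⟨s, hs0, hst, hsd, hcard⟩ := exists_card_choose_mul_pow_lt hL ht0 hd
  obtain ⟨U, hU⟩ := exists_qunitary_family_sum_sq_le hcard
  refine ⟨U, fun ψ hψ => htarget.trans ?_⟩
  have h192 : 0 ≤ Real.logb 2 (192 * Real.logb 2 (t : ℝ)) :=
    Real.logb_nonneg one_lt_two (by linarith)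
  -- For `d < 192 log t` the comparison bound is negative. Otherwise `s ≥ 64`, as the entropy
  -- estimate requires.
  rcases lt_or_ge (Real.logb 2 (d : ℝ)) (Real.logb 2 (192 * Real.logb 2 (t : ℝ))) with hlt | hge
  · refine le_trans ?_ (avgMeasurementEntropy_nonneg U hψ)
    have : 0 ≤ 64 / (t : ℝ) * Real.logb 2 d := by positivity
    linarith
  have hge' : 192 * Real.logb 2 (t : ℝ) ≤ d :=
    (Real.logb_le_logb one_lt_two (by positivity) (by linarith)).mp hge
  have hs64 : d / (192 * Real.logb 2 (t : ℝ)) ≤ s / 64 := by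
    rw [le_div_iff₀ (by norm_num)]
    refine le_trans (le_of_eq ?_) hsd
    field_simp
    norm_num
  have h64s : (64 : ℝ) ≤ s := by
    have : 1 ≤ d / (192 * Real.logb 2 (t : ℝ)) := by rwa [one_le_div (by positivity)]
    linarith
  have hent := le_avgMeasurementEntropy (M := 64) ht0 hs0 (by norm_num) hst h64s U hψ
    (fun S hS => hU ψ hψ.le S hS)
  refine le_trans ?_ hent
  have hlog := Real.logb_le_logb_of_le one_lt_two (by positivity) hs64
  rw [Real.logb_div (by linarith) (by positivity)] at hlog
  have h1 := mul_le_mul_of_nonneg_left hlog (sub_nonneg.mpr ht64)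
  have h2 : 0 ≤ 64 / (t : ℝ) * Real.logb 2 (192 * Real.logb 2 (t : ℝ)) := by positivity
  linarith

/-! ### The asymptotic form. -/

theorem tendsto_logb_two_natCast_atTop : Tendsto (fun d : ℕ => Real.logb 2 (d : ℝ)) atTop atTop :=
  (Real.tendsto_logb_atTop one_lt_two).comp tendsto_natCast_atTop_atTop

theorem exists_qunitary_families_le_liminf {t : ℕ} (ht : 2 < t) :
    ∃ U : (d : ℕ) → Fin t → QUnitary d,
      ∀ ψ : (d : ℕ) → QSpace d, (∀ d : ℕ, 0 < d → ‖ψ d‖ = 1) →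
        1 - Real.sqrt (64 * Real.logb 2 (t : ℝ) / (t : ℝ))
          ≤ liminf (fun d : ℕ => avgMeasurementEntropy (U d) (ψ d) / Real.logb 2 (d : ℝ))
              atTop := by
  classical
  let U : (d : ℕ) → Fin t → QUnitary d := fun d =>
    if hd : 128 * (t : ℝ) / Real.logb 2 t ≤ d then
      (exists_qunitary_family_avgMeasurementEntropy ht hd).choose
    else fun _ => LinearIsometryEquiv.refl ℂ _
  refine ⟨U, fun ψ hψ => ?_⟩
  set a := 1 - Real.sqrt (64 * Real.logb 2 (t : ℝ) / (t : ℝ)) with ha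
  set b := Real.logb 2 (18 * (t : ℝ) / (64 * Real.logb 2 t))
    + etaFn (Real.sqrt (64 * Real.logb 2 (t : ℝ) / t)) with hb
  have hlog := tendsto_logb_two_natCast_atTop
  have hlow : ∀ᶠ d : ℕ in atTop, a - b / Real.logb 2 (d : ℝ)
      ≤ avgMeasurementEntropy (U d) (ψ d) / Real.logb 2 (d : ℝ) := by
    filter_upwards [tendsto_natCast_atTop_atTop.eventually_ge_atTop (128 * (t : ℝ) / Real.logb 2 t),
      hlog.eventually_gt_atTop 0, eventually_gt_atTop 0] with d hd hd0 hdpos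
    have h := (exists_qunitary_family_avgMeasurementEntropy ht hd).choose_spec (ψ d) (hψ d hdpos)
    have hUd : U d = (exists_qunitary_family_avgMeasurementEntropy ht hd).choose := dif_pos hd
    rw [← hUd] at h
    rw [le_div_iff₀ hd0, sub_mul, div_mul_cancel₀ _ hd0.ne']
    linarith
  -- A real liminf is meaningful only for a sequence that does not tend to infinity; `H ≤ log d`
  -- supplies the upper bound.
  have hup : ∀ᶠ d : ℕ in atTop,
      avgMeasurementEntropy (U d) (ψ d) / Real.logb 2 (d : ℝ) ≤ 1 := by
    filter_upwards [hlog.eventually_gt_atTop 0, eventually_gt_atTop 0] with d hd0 hdpos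
    rw [div_le_one hd0]
    exact avgMeasurementEntropy_le hdpos (by omega) _ (hψ d hdpos)
  have hlim : Tendsto (fun d : ℕ => a - b / Real.logb 2 (d : ℝ)) atTop (𝓝 a) := by
    simpa using tendsto_const_nhds.sub (hlog.const_div_atTop b)
  rw [← hlim.liminf_eq]
  exact liminf_le_liminf hlow hlim.isBoundedUnder_ge
    (isBoundedUnder_of_eventually_le hup).isCoboundedUnder_ge

theorem tendsto_sqrt_div_const_mul_logb {c : ℝ} (hc : 0 < c) :
    Tendsto (fun t : ℕ => Real.sqrt ((t : ℝ) / (c * Real.logb 2 (t : ℝ)))) atTop atTop := by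
  refine Real.tendsto_sqrt_atTop.comp ?_
  have h1 : Tendsto (fun x : ℝ => c * Real.logb 2 x / x) atTop (𝓝 0) := by
    have h := (Real.isLittleO_log_id_atTop.tendsto_div_nhds_zero).const_mul (c / Real.log 2)
    rw [mul_zero] at h
    refine h.congr fun x => ?_
    simp only [Real.logb, id]
    ring
  have h2 : Tendsto (fun x : ℝ => c * Real.logb 2 x / x) atTop (𝓝[>] 0) := by
    refine tendsto_nhdsWithin_iff.mpr ⟨h1, ?_⟩
    filter_upwards [eventually_gt_atTop 1] with x hx
    have := Real.logb_pos one_lt_two hx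
    have hx0 : 0 < x := by linarith
    exact div_pos (mul_pos hc this) hx0
  refine (h2.inv_tendsto_nhdsGT_zero.comp tendsto_natCast_atTop_atTop).congr fun t => ?_
  simp

theorem mainTheorem7 :
    ∃ c' : ℝ, 1 ≤ c' ∧
      -- the entropic uncertainty relation in fixed dimension
      (∀ d t : ℕ, 2 < d → 2 < t →
        (9 * 16 ^ 2 * (t : ℝ)) / (18 * Real.logb 2 (t : ℝ)) ≤ (d : ℝ) →
        ∃ U : Fin t → QUnitary d, ∀ ψ : QSpace d, ‖ψ‖ = 1 →
          (1 - Real.sqrt (c' * Real.logb 2 (t : ℝ) / (t : ℝ))) * Real.logb 2 (d : ℝ)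
              - Real.logb 2 (18 * (t : ℝ) / (c' * Real.logb 2 (t : ℝ)))
              - etaFn (Real.sqrt (c' * Real.logb 2 (t : ℝ) / (t : ℝ)))
            ≤ avgMeasurementEntropy U ψ) ∧
      -- the asymptotic form, for one sequence of families and all sequences of states
      (∀ t : ℕ, 2 < t →
        ∃ U : (d : ℕ) → Fin t → QUnitary d,
          ∀ ψ : (d : ℕ) → QSpace d, (∀ d : ℕ, 0 < d → ‖ψ d‖ = 1) →
            1 - Real.sqrt (c' * Real.logb 2 (t : ℝ) / (t : ℝ))
              ≤ liminf (fun d : ℕ => avgMeasurementEntropy (U d) (ψ d) / Real.logb 2 (d : ℝ))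
                  atTop) ∧
      -- the bound is `1 - 1 / f(t)` for a function `f` growing to infinity
      Tendsto (fun t : ℕ => Real.sqrt ((t : ℝ) / (c' * Real.logb 2 (t : ℝ)))) atTop atTop := by
  refine ⟨64, by norm_num, fun d t _ ht hd => ?_, fun t ht => exists_qunitary_families_le_liminf ht,
    tendsto_sqrt_div_const_mul_logb (by norm_num)⟩
  refine exists_qunitary_family_avgMeasurementEntropy ht (le_trans (le_of_eq ?_) hd)
  -- The dimension condition is `128 t / log t ≤ d`.
  rw [show 9 * 16 ^ 2 * (t : ℝ) = 18 * (128 * t) by ring, mul_div_mul_left _ _ (by norm_num)]
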